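/- Let $n\ge 2$. Two robots $\mathfrak i\in\{i,j\}$ have states $x^{\mathfrak i}\in\mathbb R^n$ and single-integrator dynamics $\dot x^{\mathfrak i}=u^{\mathfrak i}$; write $x=(x^i,x^j)\in\mathbb R^{2n}$ and $u=(u^i,u^j)\in\mathbb R^{2n}$, so that $\dot x=u$. Robot $\mathfrak i$ occupies a polygon with $r^{\mathfrak i}$ edges and $r^{\mathfrak i}$ vertices, $$\mathcal P^{\mathfrak i}(x^{\mathfrak i})=\{z\in\mathbb R^2: A^{\mathfrak i}_k(x^{\mathfrak i})^\top z\le b^{\mathfrak i}_k(x^{\mathfrak i}),\ 1\le k\le r^{\mathfrak i}\}=\operatorname{co}\{v^{\mathfrak i}_1(x^{\mathfrak i}),\dots,v^{\mathfrak i}_{r^{\mathfrak i}}(x^{\mathfrak i})\},$$ which for every $x^{\mathfrak i}\in\mathbb R^n$ is convex, bounded and has nonempty interior, the $v^{\mathfrak i}_k(x^{\mathfrak i})$ being its distinct vertices. Assume that all $A^{\mathfrak i}_k,b^{\mathfrak i}_k,v^{\mathfrak i}_k$ are $C^1$ functions of $x^{\mathfrak i}$, that none of the inequalities is redundant, that $\|A^{\mathfrak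 i}_k\|=1$, and that the Jacobian of each $v^{\mathfrak i}_k$ has full row rank everywhere. Let $h_s(x)=\operatorname{sd}(\mathcal P^i(x^i),\mathcal P^j(x^j))$, where $\operatorname{sd}(P,Q)=\inf\{\|t\|:(P+t)\cap Q\ne\emptyset\}-\inf\{\|t\|:(P+t)\cap Q=\emptyset\}$, and $\mathcal S=\{x:h_s(x)\ge 0\}$. For $\kappa>0$ and $b\in\mathbb R$ put $$\hat h_a(x)=\frac1\kappa\ln\Bigg(\sum_{k=1}^{r^i}\frac1{\sum_{l=1}^{r^j}e^{-\kappa(A^i_k(x^i)^\top v^j_l(x^j)-b^i_k(x^i))}}+\sum_{k=1}^{r^j}\frac1{\sum_{l=1}^{r^i}e^{-\kappa(A^j_k(x^j)^\top v^i_l(x^i)-b^j_k(x^j))}}\Bigg)-\frac b\kappa$$ and $\hat{\mathcal S}_a=\{x:\hat h_a(x)\ge 0\}$. An extended class-$\mathcal K$ function is a continuous, strictly increasing $\alpha:\mathbb R\to\mathbb R$ with $\alpha(0)=0$. A $C^1$ function $h$ is a control barrier function (CBF) for $\dot x=u$ on an open set $D\supseteq C$, where $C$ is a nonempty closed set without isolated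 points, if $h=0$ on $\partial C$, $h>0$ on $\operatorname{Int}C$, $h<0$ on $C^c$, and for some extended class-$\mathcal K$ function $\alpha$ there is, for every $x\in D$, an input $u$ with $\nabla h(x)^\top u\ge-\alpha(h(x))$. For a locally Lipschitz $u_0:\mathbb R^{2n}\to\mathbb R^{2n}$ and an extended class-$\mathcal K$ function $\alpha$, the distributed safety filter is $$u_*(x)=\operatorname*{argmin}_{u\in\mathbb R^{2n}}\|u-u_0(x)\|^2\quad\text{s.t.}\quad \nabla_{x^{\mathfrak i}}\hat h_a(x)^\top u^{\mathfrak i}\ge-\tfrac12\alpha(\hat h_a(x)),\ \mathfrak i\in\{i,j\},$$ defined at those $x$ at which this program has a minimizer (which is then unique). A solution of the closed loop $\dot x=u_*(x)$ on $[0,T)$, $0<T\le\infty$, is a differentiable curve that satisfies the equation, with $u_*(x(t))$ defined, for all $t\in[0,T)$. Theorem. Let $b\ge\ln(r^i+r^j)$. (a) If $h_s(x)>0$ for some $x$, then $\hat{\mathcal S}_a\neq\emptyset$ for all sufficiently large $\kappa$. (b) Let $\kappa>0$ be such that $\hat{\mathcal S}_a\ne\emptyset$, and suppose that $\nabla\hat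 h_a(x)\ne0$ for all $x$ with $\hat h_a(x)=0$. Then there is an open set $\hat{\mathcal D}_a\supseteq\hat{\mathcal S}_a$ such that: i) $\hat h_a$ is a continuously differentiable CBF for $\dot x=u$ on $\hat{\mathcal D}_a\supseteq\hat{\mathcal S}_a$ (with $C=\hat{\mathcal S}_a$). ii) For every locally Lipschitz $u_0$ and every extended class-$\mathcal K$ function $\alpha$, the filter $u_*$ is defined on $\hat{\mathcal S}_a$, and $\hat{\mathcal S}_a$ is forward invariant for $\dot x=u_*(x)$: every solution with $x(0)\in\hat{\mathcal S}_a$ satisfies $x(t)\in\hat{\mathcal S}_a$ for all $t\in[0,T)$. Consequently the closed loop is safe with respect to $\mathcal S$: every such solution satisfies $x(t)\in\mathcal S$ for all $t\in[0,T)$. -/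

import Mathlib

namespace PolygonCBF

/-! ### Control-affine systems and control barrier functions -/

section Control

variable {X U : Type*} [NormedAddCommGroup X] [InnerProductSpace ℝ X] [CompleteSpace X]
  [NormedAddCommGroup U] [InnerProductSpace ℝ U]

/-- Extended class-`K` functions. -/
structure IsExtendedClassK (α : ℝ → ℝ) : Prop where
  continuous : Continuous α
  strictMono : StrictMono α
  map_zero : α 0 = 0

/-- `h` is a (possibly nonsmooth) barrier function candidate on `C`, a nonempty closed set
without isolated points. -/
structure IsBFCandidate (C : Set X) (h : X → ℝ) : Prop where
  nonempty : C.Nonempty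
  isClosed : IsClosed C
  no_isolated : Preperfect C
  locallyLipschitz : LocallyLipschitz h
  eq_zero : ∀ x ∈ frontier C, h x = 0
  pos : ∀ x ∈ interior C, 0 < h x
  neg : ∀ x ∈ Cᶜ, h x < 0

/-- The set `K(x)` of inputs with `ḣ(x, u) ≥ -α (h x)` for the system `ẋ = f x + g x u`. -/
def admissibleInputs (f : X → X) (g : X → U →L[ℝ] X) (h : X → ℝ) (α : ℝ → ℝ) (x : X) : Set U :=
  {u | -α (h x) ≤ inner ℝ (gradient h x) (f x + g x u)}

/-- `h`, a continuously differentiable barrier function candidate on `C`, is a control barrier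
function on `D` for `ẋ = f x + g x u`. -/
structure IsCBF (f : X → X) (g : X → U →L[ℝ] X) (C D : Set X) (h : X → ℝ) : Prop where
  contDiff : ContDiff ℝ 1 h
  candidate : IsBFCandidate C h
  isOpen : IsOpen D
  subset : C ⊆ D
  exists_input : ∃ α : ℝ → ℝ, IsExtendedClassK α ∧
    ∀ x ∈ D, (admissibleInputs f g h α x).Nonempty

/-- `x` solves `ẋ = f x + g x k(x)` on `[0, T)`, where `T = ⊤` is allowed. The feedback `k` is
given by its graph: `k x` is the set of values of the feedback at `x`, empty where the feedback is
undefined, and a solution has to stay where it is defined. -/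
def IsClosedLoopSolution (f : X → X) (g : X → U →L[ℝ] X) (k : X → Set U)
    (T : EReal) (x : ℝ → X) : Prop :=
  ∀ t : ℝ, 0 ≤ t → (t : EReal) < T →
    ∃ u ∈ k (x t), HasDerivWithinAt x (f (x t) + g (x t) u) {s : ℝ | 0 ≤ s ∧ (s : EReal) < T} t

/-- Every solution of the closed loop that starts in `C₀` stays in `C` as long as it exists. -/
def StaysIn (f : X → X) (g : X → U →L[ℝ] X) (k : X → Set U) (C₀ C : Set X) : Prop :=
  ∀ (T : EReal) (x : ℝ → X), IsClosedLoopSolution f g k T x → x 0 ∈ C₀ →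
    ∀ t : ℝ, 0 ≤ t → (t : EReal) < T → x t ∈ C

/-- Forward invariance of `C` for the closed loop. -/
def ForwardInvariant (f : X → X) (g : X → U →L[ℝ] X) (k : X → Set U) (C : Set X) : Prop :=
  StaysIn f g k C C

end Control

/-! ### Signed distance -/

/-- The plane `ℝ²` with its Euclidean norm. -/
abbrev Plane : Type := EuclideanSpace ℝ (Fin 2)

/-- `dist(P, Q) = inf {‖t‖ : (P + t) ∩ Q ≠ ∅}`. -/
noncomputable def separation (P Q : Set Plane) : ℝ :=
  sInf {d : ℝ | ∃ t : Plane, (((fun z => z + t) '' P) ∩ Q).Nonempty ∧ d = ‖t‖}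

/-- `pen(P, Q) = inf {‖t‖ : (P + t) ∩ Q = ∅}`. -/
noncomputable def penetration (P Q : Set Plane) : ℝ :=
  sInf {d : ℝ | ∃ t : Plane, ((fun z => z + t) '' P) ∩ Q = ∅ ∧ d = ‖t‖}

/-- The signed distance `sd(P, Q) = dist(P, Q) - pen(P, Q)`. -/
noncomputable def signedDistance (P Q : Set Plane) : ℝ :=
  separation P Q - penetration P Q

/-! ### State-dependent polygons -/

/-- The state of one robot. -/
abbrev RobotState (n : ℕ) : Type := EuclideanSpace ℝ (Fin n)

/-- The data of a polygon with `r` edges and `r` vertices that depends on a state in `ℝⁿ`: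
the rows `A x k` and `b x k` of its halfspace representation and its vertices `v x k`. -/
structure PolygonFamily (n r : ℕ) where
  A : RobotState n → Fin r → Plane
  b : RobotState n → Fin r → ℝ
  v : RobotState n → Fin r → Plane

/-- The polygon `{z : A(x) z ≤ b(x)}`. -/
def PolygonFamily.body {n r : ℕ} (P : PolygonFamily n r) (x : RobotState n) : Set Plane :=
  {z | ∀ k, inner ℝ (P.A x k) z ≤ P.b x k}

/-- The standing assumptions on a state-dependent polygon. -/
structure PolygonFamily.IsRegular {n r : ℕ} (P : PolygonFamily n r) : Prop where
  /-- The vertex representation describes the same polygon as the halfspace representation. -/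
  body_eq_convexHull : ∀ x, P.body x = convexHull ℝ (Set.range (P.v x))
  /-- The points `v x k` are pairwise distinct. -/
  v_injective : ∀ x, Function.Injective (P.v x)
  /-- The points `v x k` are vertices (extreme points). -/
  v_extreme : ∀ x k, P.v x k ∈ Set.extremePoints ℝ (P.body x)
  convex : ∀ x, Convex ℝ (P.body x)
  bounded : ∀ x, Bornology.IsBounded (P.body x)
  interior_nonempty : ∀ x, (interior (P.body x)).Nonempty
  contDiff_A : ∀ k, ContDiff ℝ 1 (fun x => P.A x k)
  contDiff_b : ∀ k, ContDiff ℝ 1 (fun x => P.b x k)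
  /-- No inequality is redundant: dropping any of them changes the set. -/
  irredundant : ∀ x k, {z | ∀ m, m ≠ k → inner ℝ (P.A x m) z ≤ P.b x m} ≠ P.body x
  norm_A : ∀ x k, ‖P.A x k‖ = 1
  contDiff_v : ∀ k, ContDiff ℝ 1 (fun x => P.v x k)
  /-- The Jacobian of each vertex has full row rank. -/
  fderiv_v_surjective : ∀ x k, Function.Surjective (fderiv ℝ (fun y => P.v y k) x)

/-! ### The two-robot problem -/

/-- The joint state `x = (xⁱ, xʲ) ∈ ℝ²ⁿ` with its Euclidean norm. -/
abbrev JointState (n : ℕ) : Type := WithLp 2 (RobotState n × RobotState n)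

section TwoRobots

variable {n ri rj : ℕ}

/-- Drift of the single integrator `ẋ = u`. -/
def integratorDrift (n : ℕ) : JointState n → JointState n := fun _ => 0

/-- Input map of the single integrator `ẋ = u`. -/
noncomputable def integratorInput (n : ℕ) : JointState n → JointState n →L[ℝ] JointState n :=
  fun _ => ContinuousLinearMap.id ℝ (JointState n)

/-- `h_s(x) = sd(Pⁱ(xⁱ), Pʲ(xʲ))`. -/
noncomputable def hs (Pi : PolygonFamily n ri) (Pj : PolygonFamily n rj) (x : JointState n) : ℝ :=
  signedDistance (Pi.body x.fst) (Pj.body x.snd)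

/-- The safe set `S = {x : h_s(x) ≥ 0}`. -/
def safeSet (Pi : PolygonFamily n ri) (Pj : PolygonFamily n rj) : Set (JointState n) :=
  {x | 0 ≤ hs Pi Pj x}

/-- `⟨A_k(y), v_l(z)⟩ - b_k(y)`: the signed distance from the `l`-th vertex of the polygon `Q(z)` to
the `k`-th halfplane of the polygon `P(y)`. -/
noncomputable def component {r s : ℕ} (P : PolygonFamily n r) (Q : PolygonFamily n s)
    (y z : RobotState n) (k : Fin r) (l : Fin s) : ℝ :=
  inner ℝ (P.A y k) (Q.v z l) - P.b y k

/-- The smoothed max-min `∑ₖ (∑ₗ exp(κ · componentₖₗ)⁻¹)⁻¹`. -/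
noncomputable def softMaxMin {r s : ℕ} (κ : ℝ) (P : PolygonFamily n r) (Q : PolygonFamily n s)
    (y z : RobotState n) : ℝ :=
  ∑ k : Fin r, 1 / ∑ l : Fin s, 1 / Real.exp (κ * component P Q y z k l)

/-- The log-sum-exp smoothing `ĥ_a(x; b, κ)` with buffer `b` and smoothing parameter `κ`. -/
noncomputable def hHat (Pi : PolygonFamily n ri) (Pj : PolygonFamily n rj) (b κ : ℝ)
    (x : JointState n) : ℝ :=
  1 / κ * Real.log (softMaxMin κ Pi Pj x.fst x.snd + softMaxMin κ Pj Pi x.snd x.fst) - b / κ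

/-- The zero-superlevel set `Ŝ_a(b, κ)` of `ĥ_a`. -/
def hatSet (Pi : PolygonFamily n ri) (Pj : PolygonFamily n rj) (b κ : ℝ) : Set (JointState n) :=
  {x | 0 ≤ hHat Pi Pj b κ x}

/-- The feasible inputs at `x` of the distributed quadratic program:
`⟨∇_{xⁱ} h(x), uⁱ⟩ ≥ -α(h x)/2` and `⟨∇_{xʲ} h(x), uʲ⟩ ≥ -α(h x)/2`. -/
def qpFeasible (h : JointState n → ℝ) (α : ℝ → ℝ) (x : JointState n) : Set (JointState n) :=
  {u | -(1 / 2) * α (h x) ≤ inner ℝ (gradient h x).fst u.fst ∧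
    -(1 / 2) * α (h x) ≤ inner ℝ (gradient h x).snd u.snd}

/-- The distributed safety filter: the set of minimizers of `‖u - u₀(x)‖²` over the feasible
inputs. It has at most one element. -/
def safetyFilter (h : JointState n → ℝ) (α : ℝ → ℝ) (u₀ : JointState n → JointState n)
    (x : JointState n) : Set (JointState n) :=
  {u | u ∈ qpFeasible h α x ∧ ∀ w ∈ qpFeasible h α x, ‖u - u₀ x‖ ^ 2 ≤ ‖w - u₀ x‖ ^ 2}

end TwoRobots

end PolygonCBF

open PolygonCBF

open Filter Topology

/-! Safety: the argument of the logarithm in `hHat` is a sum of `ri + rj` positive terms, one per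
edge, and it is at least `exp b ≥ ri + rj` on `hatSet`. Hence some term is at least 1, which forces
every vertex of the other polygon weakly outside that edge. An arbitrarily small shift along the
edge normal then makes the polygons disjoint, so `hs ≥ 0` (`hatSet_subset_safeSet`).

Nonemptiness: positive signed distance means disjoint polygons, which by Helly's theorem are
strictly separated by an edge of one of them (`exists_separating_edge`). The term of that edge tends
to infinity with `κ`.

Barrier: `hHat` is `C¹`, and a nonzero gradient on its zero level makes its sign match `hatSet` and
lets the input be chosen along the gradient (`isCBF_integrator`). The two constraints of the filter
add up to the barrier inequality, under which a trajectory cannot leave the superlevel set, since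
the barrier increases wherever it is negative (`forwardInvariant_superlevel`). -/

namespace PolygonCBF

/-! ### Barrier functions, forward invariance and projection in Hilbert space. -/

section Control

variable {X U : Type*} [NormedAddCommGroup X] [InnerProductSpace ℝ X] [CompleteSpace X]
  [NormedAddCommGroup U] [InnerProductSpace ℝ U]

/-- The superlevel set of a continuous function with nonzero gradient on its zero level set has no
isolated points. -/
theorem preperfect_superlevel [Nontrivial X] {h : X → ℝ} (hc : Continuous h)
    (hreg : ∀ x, h x = 0 → gradient h x ≠ 0) : Preperfect {x | 0 ≤ h x} := by
  intro x hx
  rw [accPt_iff_frequently_nhdsNE]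
  rcases (show 0 ≤ h x from hx).lt_or_eq with hpos | hzero
  · have hev : ∀ᶠ y in 𝓝[≠] x, y ∈ {x | 0 ≤ h x} :=
      ((hc.tendsto x).eventually (lt_mem_nhds hpos)).filter_mono nhdsWithin_le_nhds
        |>.mono fun y hy => le_of_lt hy
    have : (𝓝[≠] x).NeBot := Module.punctured_nhds_neBot ℝ X x
    exact hev.frequently
  -- At an isolated zero, `h` would be negative all around, so `x` would be a local maximum.
  · intro hev
    refine hreg x hzero.symm ?_
    have hmax : IsLocalMax h x := by
      have := eventually_nhdsWithin_iff.mp hev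
      filter_upwards [this] with y hy
      by_cases hyx : y = x
      · rw [hyx]
      · exact (not_le.mp (hy hyx)).le.trans hzero.le
    rw [gradient, hmax.fderiv_eq_zero, map_zero]

/-- A `C¹` function that is regular on its zero level set is a barrier function candidate. -/
theorem isBFCandidate_superlevel [Nontrivial X] {h : X → ℝ} (hC : ContDiff ℝ 1 h)
    (hne : {x | 0 ≤ h x}.Nonempty) (hreg : ∀ x, h x = 0 → gradient h x ≠ 0) :
    IsBFCandidate {x | 0 ≤ h x} h where
  nonempty := hne
  isClosed := isClosed_le continuous_const hC.continuous
  no_isolated := preperfect_superlevel hC.continuous hreg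
  locallyLipschitz := hC.locallyLipschitz
  eq_zero x hx := (frontier_le_subset_eq continuous_const hC.continuous hx).symm
  pos x hx := by
    refine lt_of_le_of_ne (interior_subset hx : x ∈ {x | 0 ≤ h x}) fun hzero => ?_
    refine hreg x hzero.symm ?_
    have hmin : IsLocalMin h x := by
      filter_upwards [mem_interior_iff_mem_nhds.mp hx] with y hy
      exact hzero.symm.le.trans hy
    rw [gradient, hmin.fderiv_eq_zero, map_zero]
  neg x hx := not_le.mp hx

theorem continuous_gradient {h : X → ℝ} (hC : ContDiff ℝ 1 h) : Continuous (gradient h) :=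
  (InnerProductSpace.toDual ℝ X).symm.continuous.comp (hC.continuous_fderiv one_ne_zero)

/-- A feedback whose values satisfy the barrier inequality keeps the superlevel set of the barrier
forward invariant. -/
theorem forwardInvariant_superlevel {f : X → X} {g : X → U →L[ℝ] X} {k : X → Set U} {h : X → ℝ}
    {α : ℝ → ℝ} (hd : Differentiable ℝ h) (hα : IsExtendedClassK α)
    (hk : ∀ x, k x ⊆ admissibleInputs f g h α x) : ForwardInvariant f g k {x | 0 ≤ h x} := by
  intro T x hsol hx0 t ht0 htT
  by_contra hneg
  replace hneg : h (x t) < 0 := not_le.mp hneg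
  have hsub : Set.Icc 0 t ⊆ {s : ℝ | 0 ≤ s ∧ (s : EReal) < T} := fun s hs =>
    ⟨hs.1, lt_of_le_of_lt (EReal.coe_le_coe_iff.mpr hs.2) htT⟩
  have hxc : ContinuousOn x (Set.Icc 0 t) := fun s hs => by
    obtain ⟨u, -, hu⟩ := hsol s hs.1 (hsub hs).2
    exact hu.continuousWithinAt.mono hsub
  have hφc : ContinuousOn (h ∘ x) (Set.Icc 0 t) := hd.continuous.comp_continuousOn hxc
  have hcomp : IsCompact (Set.Icc 0 t ∩ (h ∘ x) ⁻¹' Set.Ici 0) :=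
    isCompact_Icc.of_isClosed_subset (hφc.preimage_isClosed_of_isClosed isClosed_Icc isClosed_Ici)
      Set.inter_subset_left
  -- `t₀` is the last time in `[0, t]` with `h ≥ 0`; afterwards `h < 0`, so its derivative is at
  -- least `-α h > 0`.
  obtain ⟨t₀, ⟨ht₀, hφt₀⟩, hmax⟩ := hcomp.exists_isGreatest ⟨0, ⟨le_rfl, ht0⟩, hx0⟩
  have hlt : t₀ < t := lt_of_le_of_ne ht₀.2 fun heq => by
    rw [heq] at hφt₀
    exact absurd hφt₀ (not_le.mpr hneg)
  have hmono : StrictMonoOn (h ∘ x) (Set.Icc t₀ t) := by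
    refine strictMonoOn_of_deriv_pos (convex_Icc t₀ t)
      (hφc.mono (Set.Icc_subset_Icc_left ht₀.1)) fun s hs => ?_
    rw [interior_Icc] at hs
    have hs0 : 0 < s := ht₀.1.trans_lt hs.1
    have hφs : h (x s) < 0 := by
      by_contra hge
      exact absurd (hmax ⟨⟨hs0.le, hs.2.le⟩, not_lt.mp hge⟩) (not_le.mpr hs.1)
    obtain ⟨u, hu, hder⟩ := hsol s hs0.le (hsub ⟨hs0.le, hs.2.le⟩).2
    have hder' := hder.hasDerivAt
      (mem_of_superset (Icc_mem_nhds hs0 hs.2) hsub)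
    have hchain := (hd (x s)).hasFDerivAt.comp_hasDerivAt s hder'
    rw [hchain.deriv, ← inner_gradient_left]
    have hadm : -α (h (x s)) ≤ inner ℝ (gradient h (x s)) (f (x s) + g (x s) u) := hk _ hu
    have : α (h (x s)) < 0 := hα.map_zero ▸ hα.strictMono hφs
    linarith
  have := hmono ⟨le_rfl, hlt.le⟩ ⟨hlt.le, le_rfl⟩ hlt
  exact absurd (hφt₀.trans this.le) (not_le.mpr hneg)

/-- Existence and uniqueness of the projection onto a nonempty closed convex set. -/
theorem existsUnique_norm_sub_sq_le {K : Set X} (hne : K.Nonempty) (hcl : IsClosed K)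
    (hconv : Convex ℝ K) (p : X) : ∃! u, u ∈ K ∧ ∀ w ∈ K, ‖u - p‖ ^ 2 ≤ ‖w - p‖ ^ 2 := by
  have hiff : ∀ u ∈ K, (∀ w ∈ K, ‖u - p‖ ^ 2 ≤ ‖w - p‖ ^ 2) →
      ∀ w ∈ K, inner ℝ (p - u) (w - u) ≤ 0 := fun u hu hmin => by
    refine (norm_eq_iInf_iff_real_inner_le_zero hconv hu).mp ?_
    have : Nonempty K := hne.to_subtype
    refine le_antisymm (le_ciInf fun w => ?_) (ciInf_le ⟨0, ?_⟩ (⟨u, hu⟩ : K))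
    · rw [norm_sub_rev p, norm_sub_rev p]
      exact (sq_le_sq₀ (norm_nonneg _) (norm_nonneg _)).mp (hmin w w.2)
    · rintro _ ⟨w, rfl⟩
      exact norm_nonneg _
  obtain ⟨v, hv, hvmin⟩ := exists_norm_eq_iInf_of_complete_convex hne hcl.isComplete hconv p
  refine ⟨v, ⟨hv, fun w hw => ?_⟩, fun u ⟨hu, humin⟩ => ?_⟩
  · rw [norm_sub_rev v, norm_sub_rev w, hvmin]
    refine pow_le_pow_left₀ (Real.iInf_nonneg fun _ => norm_nonneg _) ?_ 2
    refine ciInf_le ⟨0, ?_⟩ (⟨w, hw⟩ : K)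
    rintro _ ⟨w, rfl⟩
    exact norm_nonneg _
  -- Adding the variational inequalities of the two minimizers gives `‖v - u‖² ≤ 0`.
  · have h₁ := hiff u hu humin v hv
    have h₂ := (norm_eq_iInf_iff_real_inner_le_zero hconv hv).mp hvmin u hu
    have h₃ : inner ℝ (v - u) (v - u) ≤ (0 : ℝ) := by
      have heq : inner ℝ (v - u) (v - u)
          = inner ℝ (p - u) (v - u) + inner ℝ (p - v) (u - v) := by
        rw [← neg_sub v u, inner_neg_right, ← sub_eq_add_neg, ← inner_sub_left]
        congr 1
        abel
      linarith
    rw [real_inner_self_eq_norm_sq] at h₃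
    have h₄ : ‖v - u‖ = 0 := pow_eq_zero_iff two_ne_zero |>.mp (le_antisymm h₃ (sq_nonneg _))
    exact (sub_eq_zero.mp (norm_eq_zero.mp h₄)).symm

end Control

/-! ### Separation of polygons -/

/-- Two disjoint polygons in the plane are strictly separated by an edge of one of them. -/
theorem exists_separating_edge {r s : ℕ} (A : Fin r → Plane) (b : Fin r → ℝ) (B : Fin s → Plane)
    (c : Fin s → ℝ) (hP : {z | ∀ k, inner ℝ (A k) z ≤ b k}.Nonempty)
    (hQ : {z | ∀ l, inner ℝ (B l) z ≤ c l}.Nonempty)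
    (hdisj : {z | ∀ k, inner ℝ (A k) z ≤ b k} ∩ {z | ∀ l, inner ℝ (B l) z ≤ c l} = ∅) :
    (∃ k, ∀ z ∈ {z | ∀ l, inner ℝ (B l) z ≤ c l}, b k < inner ℝ (A k) z) ∨
      ∃ l, ∀ z ∈ {z | ∀ k, inner ℝ (A k) z ≤ b k}, c l < inner ℝ (B l) z := by
  by_contra! hcon
  obtain ⟨hA, hB⟩ := hcon
  have hsubA : ∀ I : Finset (Fin r), I.card ≤ 1 →
      ∃ z ∈ {z | ∀ l, inner ℝ (B l) z ≤ c l}, ∀ k ∈ I, inner ℝ (A k) z ≤ b k := fun I hI => by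
    rcases I.eq_empty_or_nonempty with rfl | ⟨k, hk⟩
    · obtain ⟨z, hz⟩ := hQ
      exact ⟨z, hz, by simp⟩
    · obtain ⟨z, hz, hzk⟩ := hA k
      exact ⟨z, hz, fun k' hk' => Finset.card_le_one.mp hI k' hk' k hk ▸ hzk⟩
  have hsubB : ∀ I : Finset (Fin s), I.card ≤ 1 →
      ∃ z ∈ {z | ∀ k, inner ℝ (A k) z ≤ b k}, ∀ l ∈ I, inner ℝ (B l) z ≤ c l := fun I hI => by
    rcases I.eq_empty_or_nonempty with rfl | ⟨l, hl⟩
    · obtain ⟨z, hz⟩ := hP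
      exact ⟨z, hz, by simp⟩
    · obtain ⟨z, hz, hzl⟩ := hB l
      exact ⟨z, hz, fun l' hl' => Finset.card_le_one.mp hI l' hl' l hl ▸ hzl⟩
  let F : Fin r ⊕ Fin s → Set Plane :=
    Sum.elim (fun k => {z | inner ℝ (A k) z ≤ b k}) (fun l => {z | inner ℝ (B l) z ≤ c l})
  have hF : (⋂ i ∈ (Finset.univ : Finset (Fin r ⊕ Fin s)), F i).Nonempty := by
    refine Convex.helly_theorem' (𝕜 := ℝ) ?_ fun I _ hI => ?_
    · rintro (k | l) -
      · exact convex_halfSpace_le (innerₛₗ ℝ (A k)).isLinear (b k)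
      · exact convex_halfSpace_le (innerₛₗ ℝ (B l)).isLinear (c l)
    · rw [finrank_euclideanSpace_fin, ← Finset.card_toLeft_add_card_toRight] at hI
      -- Of three half-planes, at most one comes from one of the two polygons. It meets the whole
      -- other polygon by `hA` or `hB`, which settles Helly's condition in the plane.
      rcases (by omega : I.toLeft.card ≤ 1 ∨ I.toRight.card ≤ 1) with h | h
      · obtain ⟨z, hz, hzI⟩ := hsubA _ h
        refine ⟨z, Set.mem_iInter₂.mpr ?_⟩
        rintro (k | l) hi
        · exact hzI k (Finset.mem_toLeft.mpr hi)
        · exact hz l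
      · obtain ⟨z, hz, hzI⟩ := hsubB _ h
        refine ⟨z, Set.mem_iInter₂.mpr ?_⟩
        rintro (k | l) hi
        · exact hz k
        · exact hzI l (Finset.mem_toRight.mpr hi)
  obtain ⟨z, hz⟩ := hF
  rw [Set.mem_iInter₂] at hz
  have : z ∈ {z | ∀ k, inner ℝ (A k) z ≤ b k} ∩ {z | ∀ l, inner ℝ (B l) z ≤ c l} :=
    ⟨fun k => hz (Sum.inl k) (Finset.mem_univ _), fun l => hz (Sum.inr l) (Finset.mem_univ _)⟩
  rw [hdisj] at this
  exact this

theorem separation_nonneg (P Q : Set Plane) : 0 ≤ separation P Q :=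
  Real.sInf_nonneg (by rintro _ ⟨t, -, rfl⟩; exact norm_nonneg t)

/-- This also covers an empty set of translations, where `sInf` is 0. -/
theorem penetration_nonneg (P Q : Set Plane) : 0 ≤ penetration P Q :=
  Real.sInf_nonneg (by rintro _ ⟨t, -, rfl⟩; exact norm_nonneg t)

theorem inter_eq_empty_of_signedDistance_pos {P Q : Set Plane} (h : 0 < signedDistance P Q) :
    P ∩ Q = ∅ := by
  by_contra hne
  have hsep : separation P Q ≤ 0 :=
    csInf_le ⟨0, by rintro _ ⟨t, -, rfl⟩; exact norm_nonneg t⟩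
      ⟨0, by simpa using Set.nonempty_iff_ne_empty.mpr hne, norm_zero.symm⟩
  have := penetration_nonneg P Q
  unfold signedDistance at h
  linarith

/-- If arbitrarily small translations make `P` and `Q` disjoint, their signed distance is
nonnegative. -/
theorem signedDistance_nonneg_of_forall_exists {P Q : Set Plane}
    (h : ∀ ε > 0, ∃ t : Plane, ‖t‖ ≤ ε ∧ ((fun z => z + t) '' P) ∩ Q = ∅) :
    0 ≤ signedDistance P Q := by
  have hpen : penetration P Q ≤ 0 := le_of_forall_pos_le_add fun ε hε => by
    obtain ⟨t, ht, hemp⟩ := h ε hε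
    have : penetration P Q ≤ ‖t‖ :=
      csInf_le ⟨0, by rintro _ ⟨t, -, rfl⟩; exact norm_nonneg t⟩ ⟨t, hemp, rfl⟩
    linarith
  have := separation_nonneg P Q
  unfold signedDistance
  linarith

theorem signedDistance_nonneg_of_unit_normal {P Q : Set Plane} {a : Plane} {c : ℝ} (ha : ‖a‖ = 1)
    (hP : ∀ z ∈ P, inner ℝ a z ≤ c) (hQ : ∀ z ∈ Q, c ≤ inner ℝ a z) :
    0 ≤ signedDistance P Q := by
  -- The shift by `-ε • a` turns the bound `c` on `P` into `c - ε`, so even touching sets come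
  -- apart.
  refine signedDistance_nonneg_of_forall_exists fun ε hε => ⟨-(ε • a), ?_, ?_⟩
  · rw [norm_neg, norm_smul, ha, mul_one, Real.norm_of_nonneg hε.le]
  · rw [Set.eq_empty_iff_forall_notMem]
    rintro _ ⟨⟨z, hz, rfl⟩, hzQ⟩
    have h₁ := hP z hz
    have h₂ := hQ _ hzQ
    simp only [inner_add_right, inner_neg_right, inner_smul_right, real_inner_self_eq_norm_sq,
      ha] at h₂
    linarith

theorem signedDistance_nonneg_of_unit_normal_right {P Q : Set Plane} {a : Plane} {c : ℝ}
    (ha : ‖a‖ = 1) (hQ : ∀ z ∈ Q, inner ℝ a z ≤ c) (hP : ∀ z ∈ P, c ≤ inner ℝ a z) :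
    0 ≤ signedDistance P Q := by
  refine signedDistance_nonneg_of_unit_normal (a := -a) (c := -c) (by rwa [norm_neg])
    (fun z hz => ?_) fun z hz => ?_
  · rw [inner_neg_left]
    exact neg_le_neg (hP z hz)
  · rw [inner_neg_left]
    exact neg_le_neg (hQ z hz)

/-! ### The smoothed barrier -/

section TwoRobots

variable {n r s ri rj : ℕ}

theorem PolygonFamily.IsRegular.body_nonempty {P : PolygonFamily n r} (hP : P.IsRegular)
    (x : RobotState n) : (P.body x).Nonempty :=
  (hP.interior_nonempty x).mono interior_subset

theorem PolygonFamily.IsRegular.v_mem_body {P : PolygonFamily n r} (hP : P.IsRegular)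
    (x : RobotState n) (k : Fin r) : P.v x k ∈ P.body x :=
  (hP.v_extreme x k).1

/-- Excludes empty sums, so that the divisors and the argument of the logarithm are positive. -/
theorem PolygonFamily.IsRegular.nonempty_fin {P : PolygonFamily n r} (hP : P.IsRegular) :
    Nonempty (Fin r) := by
  have h := hP.body_nonempty 0
  rw [hP.body_eq_convexHull, convexHull_nonempty_iff] at h
  exact Set.range_nonempty_iff_nonempty.mp h

theorem sum_exp_pos [Nonempty (Fin s)] (κ : ℝ) (P : PolygonFamily n r) (Q : PolygonFamily n s)
    (y z : RobotState n) (k : Fin r) :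
    0 < ∑ l : Fin s, 1 / Real.exp (κ * component P Q y z k l) :=
  Finset.sum_pos (fun _ _ => by positivity) Finset.univ_nonempty

theorem softMaxMin_pos [Nonempty (Fin r)] [Nonempty (Fin s)] (κ : ℝ) (P : PolygonFamily n r)
    (Q : PolygonFamily n s) (y z : RobotState n) : 0 < softMaxMin κ P Q y z :=
  Finset.sum_pos (fun k _ => one_div_pos.mpr (sum_exp_pos κ P Q y z k)) Finset.univ_nonempty

theorem hHat_nonneg_iff [Nonempty (Fin ri)] [Nonempty (Fin rj)] {Pi : PolygonFamily n ri}
    {Pj : PolygonFamily n rj} {b κ : ℝ} (hκ : 0 < κ) {x : JointState n} :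
    0 ≤ hHat Pi Pj b κ x ↔
      Real.exp b ≤ softMaxMin κ Pi Pj x.fst x.snd + softMaxMin κ Pj Pi x.snd x.fst := by
  have hpos := add_pos (softMaxMin_pos κ Pi Pj x.fst x.snd) (softMaxMin_pos κ Pj Pi x.snd x.fst)
  rw [← Real.le_log_iff_exp_le hpos, hHat, one_div_mul_eq_div, ← sub_div,
    le_div_iff₀ hκ, zero_mul, sub_nonneg]

/-- A soft max-min that is at least the number of edges comes with a separating edge. -/
theorem exists_component_nonneg [Nonempty (Fin r)] [Nonempty (Fin s)] {κ : ℝ} (hκ : 0 < κ)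
    {P : PolygonFamily n r} {Q : PolygonFamily n s} {y z : RobotState n}
    (h : (r : ℝ) ≤ softMaxMin κ P Q y z) : ∃ k, ∀ l, 0 ≤ component P Q y z k l := by
  -- Pigeonhole: one of the `r` terms is at least 1. Its denominator is then at most 1, and so is
  -- each positive summand of it.
  obtain ⟨k, -, hk⟩ := Finset.exists_le_of_sum_le
    (f := fun _ : Fin r => (1 : ℝ))
    (g := fun k => 1 / ∑ l : Fin s, 1 / Real.exp (κ * component P Q y z k l))
    (s := Finset.univ) Finset.univ_nonempty (by simpa [softMaxMin] using h)
  refine ⟨k, fun l => ?_⟩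
  have hsum : ∑ l : Fin s, 1 / Real.exp (κ * component P Q y z k l) ≤ 1 :=
    (one_le_div (sum_exp_pos κ P Q y z k)).mp hk
  have hl : 1 / Real.exp (κ * component P Q y z k l) ≤ 1 :=
    (Finset.single_le_sum (f := fun l => 1 / Real.exp (κ * component P Q y z k l))
      (fun _ _ => by positivity) (Finset.mem_univ l)).trans hsum
  rw [div_le_one (Real.exp_pos _), Real.one_le_exp_iff] at hl
  exact nonneg_of_mul_nonneg_right hl hκ

/-- A half-plane is convex, so containing the vertices suffices. -/
theorem PolygonFamily.IsRegular.le_inner_of_component_nonneg {P : PolygonFamily n r}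
    {Q : PolygonFamily n s} (hQ : Q.IsRegular) {y z : RobotState n} {k : Fin r}
    (h : ∀ l, 0 ≤ component P Q y z k l) : ∀ w ∈ Q.body z, P.b y k ≤ inner ℝ (P.A y k) w := by
  have hconv : Convex ℝ {w | P.b y k ≤ inner ℝ (P.A y k) w} :=
    convex_halfSpace_ge (innerₛₗ ℝ (P.A y k)).isLinear (P.b y k)
  rw [hQ.body_eq_convexHull]
  refine convexHull_min ?_ hconv
  rintro _ ⟨l, rfl⟩
  exact sub_nonneg.mp (h l)

theorem hatSet_subset_safeSet {Pi : PolygonFamily n ri} {Pj : PolygonFamily n rj}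
    (hPi : Pi.IsRegular) (hPj : Pj.IsRegular) {b κ : ℝ} (hκ : 0 < κ)
    (hb : Real.log ((ri : ℝ) + (rj : ℝ)) ≤ b) : hatSet Pi Pj b κ ⊆ safeSet Pi Pj := by
  intro x hx
  have := hPi.nonempty_fin
  have := hPj.nonempty_fin
  have hri : 0 < ri := Fin.pos_iff_nonempty.mpr hPi.nonempty_fin
  have hsum : (ri : ℝ) + rj ≤
      softMaxMin κ Pi Pj x.fst x.snd + softMaxMin κ Pj Pi x.snd x.fst :=
    ((Real.log_le_iff_le_exp (by positivity)).mp hb).trans ((hHat_nonneg_iff hκ).mp hx)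
  -- Two sums with total at least `ri + rj`: the first reaches `ri` or the second reaches `rj`.
  rcases le_or_gt (ri : ℝ) (softMaxMin κ Pi Pj x.fst x.snd) with hi | hi
  · obtain ⟨k, hk⟩ := exists_component_nonneg hκ hi
    exact signedDistance_nonneg_of_unit_normal (hPi.norm_A x.fst k) (fun z hz => hz k)
      (hPj.le_inner_of_component_nonneg hk)
  · obtain ⟨k, hk⟩ := exists_component_nonneg hκ (by linarith : (rj : ℝ) ≤ _)
    exact signedDistance_nonneg_of_unit_normal_right (hPj.norm_A x.snd k) (fun z hz => hz k)
      (hPi.le_inner_of_component_nonneg hk)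

/-- If some edge strictly separates the polygons, the soft max-min is unbounded in `κ`. -/
theorem exists_forall_le_softMaxMin [Nonempty (Fin s)] {P : PolygonFamily n r}
    {Q : PolygonFamily n s} {y z : RobotState n} {k : Fin r}
    (h : ∀ l, 0 < component P Q y z k l) (M : ℝ) :
    ∃ κ₀ : ℝ, 0 < κ₀ ∧ ∀ κ, κ₀ ≤ κ → M ≤ softMaxMin κ P Q y z := by
  have htend : Tendsto (fun κ => ∑ l : Fin s, 1 / Real.exp (κ * component P Q y z k l))
      atTop (𝓝[>] 0) := by
    refine tendsto_nhdsWithin_iff.mpr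
      ⟨?_, Eventually.of_forall fun κ => sum_exp_pos κ P Q y z k⟩
    rw [← Finset.sum_const_zero (s := (Finset.univ : Finset (Fin s)))]
    refine tendsto_finsetSum _ fun l _ => ?_
    simp only [one_div]
    exact (Real.tendsto_exp_atTop.comp
      (tendsto_id.atTop_mul_const (h l))).inv_tendsto_atTop
  have hev := htend.inv_tendsto_nhdsGT_zero.eventually_ge_atTop M
  obtain ⟨κ₀, hκ₀⟩ := eventually_atTop.mp hev
  -- The maximum with 1 only serves to make the threshold positive.
  refine ⟨max κ₀ 1, by positivity, fun κ hκ => ?_⟩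
  refine (hκ₀ κ ((le_max_left _ _).trans hκ)).trans ?_
  rw [Pi.inv_apply, ← one_div]
  exact Finset.single_le_sum
    (f := fun k => 1 / ∑ l : Fin s, 1 / Real.exp (κ * component P Q y z k l))
    (fun k _ => (one_div_pos.mpr (sum_exp_pos κ P Q y z k)).le) (Finset.mem_univ k)

theorem exists_forall_hatSet_nonempty {Pi : PolygonFamily n ri} {Pj : PolygonFamily n rj}
    (hPi : Pi.IsRegular) (hPj : Pj.IsRegular) (b : ℝ) {x : JointState n} (hx : 0 < hs Pi Pj x) :
    ∃ κ₀ : ℝ, 0 < κ₀ ∧ ∀ κ : ℝ, κ₀ ≤ κ → (hatSet Pi Pj b κ).Nonempty := by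
  have := hPi.nonempty_fin
  have := hPj.nonempty_fin
  rcases exists_separating_edge _ _ _ _ (hPi.body_nonempty x.fst) (hPj.body_nonempty x.snd)
    (inter_eq_empty_of_signedDistance_pos hx) with ⟨k, hk⟩ | ⟨k, hk⟩
  · obtain ⟨κ₀, hpos, hκ₀⟩ := exists_forall_le_softMaxMin (P := Pi) (Q := Pj) (k := k)
      (fun l => sub_pos.mpr (hk _ (hPj.v_mem_body x.snd l))) (Real.exp b)
    refine ⟨κ₀, hpos, fun κ hκ => ⟨x, (hHat_nonneg_iff (hpos.trans_le hκ)).mpr ?_⟩⟩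
    exact (hκ₀ κ hκ).trans (le_add_of_nonneg_right (softMaxMin_pos _ _ _ _ _).le)
  · obtain ⟨κ₀, hpos, hκ₀⟩ := exists_forall_le_softMaxMin (P := Pj) (Q := Pi) (k := k)
      (fun l => sub_pos.mpr (hk _ (hPi.v_mem_body x.fst l))) (Real.exp b)
    refine ⟨κ₀, hpos, fun κ hκ => ⟨x, (hHat_nonneg_iff (hpos.trans_le hκ)).mpr ?_⟩⟩
    exact (hκ₀ κ hκ).trans (le_add_of_nonneg_left (softMaxMin_pos _ _ _ _ _).le)

theorem contDiff_softMaxMin {E : Type*} [NormedAddCommGroup E] [NormedSpace ℝ E]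
    {P : PolygonFamily n r} {Q : PolygonFamily n s} (hP : P.IsRegular) (hQ : Q.IsRegular) (κ : ℝ)
    {p q : E → RobotState n} (hp : ContDiff ℝ 1 p) (hq : ContDiff ℝ 1 q) :
    ContDiff ℝ 1 fun x => softMaxMin κ P Q (p x) (q x) := by
  have := hQ.nonempty_fin
  refine ContDiff.sum fun k _ => ContDiff.div contDiff_const
    (ContDiff.sum fun l _ => ContDiff.div contDiff_const (ContDiff.exp (contDiff_const.mul ?_))
      fun x => (Real.exp_pos _).ne') fun x => (sum_exp_pos κ P Q (p x) (q x) k).ne'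
  exact (((hP.contDiff_A k).comp hp).inner ℝ ((hQ.contDiff_v l).comp hq)).sub
    ((hP.contDiff_b k).comp hp)

theorem contDiff_hHat {Pi : PolygonFamily n ri} {Pj : PolygonFamily n rj}
    (hPi : Pi.IsRegular) (hPj : Pj.IsRegular) (b κ : ℝ) : ContDiff ℝ 1 (hHat Pi Pj b κ) := by
  have := hPi.nonempty_fin
  have := hPj.nonempty_fin
  have hfst : ContDiff ℝ 1 fun x : JointState n => x.fst :=
    (WithLp.fstL 2 ℝ (RobotState n) (RobotState n)).contDiff
  have hsnd : ContDiff ℝ 1 fun x : JointState n => x.snd :=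
    (WithLp.sndL 2 ℝ (RobotState n) (RobotState n)).contDiff
  refine ContDiff.sub (contDiff_const.mul (ContDiff.log
    ((contDiff_softMaxMin hPi hPj κ hfst hsnd).add (contDiff_softMaxMin hPj hPi κ hsnd hfst))
    fun x => ?_)) contDiff_const
  exact (add_pos (softMaxMin_pos κ Pi Pj x.fst x.snd) (softMaxMin_pos κ Pj Pi x.snd x.fst)).ne'

/-! ### The single integrator and the safety filter -/

theorem mem_admissibleInputs_integrator {h : JointState n → ℝ} {α : ℝ → ℝ} {x u : JointState n} :
    u ∈ admissibleInputs (integratorDrift n) (integratorInput n) h α x ↔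
      -α (h x) ≤ inner ℝ (gradient h x) u := by
  simp [admissibleInputs, integratorDrift, integratorInput]

/-- For the single integrator, regularity on the zero level set makes a function a control barrier
function near its superlevel set. -/
theorem isCBF_integrator [Nontrivial (JointState n)] {h : JointState n → ℝ} (hC : ContDiff ℝ 1 h)
    (hne : {x | 0 ≤ h x}.Nonempty) (hreg : ∀ x, h x = 0 → gradient h x ≠ 0) :
    IsCBF (integratorDrift n) (integratorInput n) {x | 0 ≤ h x}
      ({x | 0 < h x} ∪ {x | gradient h x ≠ 0}) h where
  contDiff := hC
  candidate := isBFCandidate_superlevel hC hne hreg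
  isOpen := (isOpen_lt continuous_const hC.continuous).union
    (isOpen_ne_fun (continuous_gradient hC) continuous_const)
  subset x hx := (show 0 ≤ h x from hx).lt_or_eq.imp id fun h0 => hreg x h0.symm
  exists_input := by
    -- With `α = id`, the input 0 works where `h > 0`; where the gradient is nonzero, a multiple of
    -- it attains equality.
    refine ⟨id, ⟨continuous_id, strictMono_id, rfl⟩, ?_⟩
    rintro x (hx | hx)
    · refine ⟨0, mem_admissibleInputs_integrator.mpr ?_⟩
      rw [inner_zero_right]
      exact (neg_neg_of_pos hx).le
    · refine ⟨(-h x / ‖gradient h x‖ ^ 2) • gradient h x, mem_admissibleInputs_integrator.mpr ?_⟩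
      rw [inner_smul_right, real_inner_self_eq_norm_sq,
        div_mul_cancel₀ _ (pow_ne_zero 2 (norm_ne_zero_iff.mpr hx))]
      rfl

theorem qpFeasible_subset_admissibleInputs (h : JointState n → ℝ) (α : ℝ → ℝ) (x : JointState n) :
    qpFeasible h α x ⊆ admissibleInputs (integratorDrift n) (integratorInput n) h α x := by
  rintro u ⟨hi, hj⟩
  rw [mem_admissibleInputs_integrator, WithLp.prod_inner_apply]
  change _ ≤ inner ℝ (gradient h x).fst u.fst + inner ℝ (gradient h x).snd u.snd
  linarith

theorem isClosed_qpFeasible (h : JointState n → ℝ) (α : ℝ → ℝ) (x : JointState n) :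
    IsClosed (qpFeasible h α x) :=
  (isClosed_le continuous_const ((innerSL ℝ (gradient h x).fst).comp
    (WithLp.fstL 2 ℝ (RobotState n) (RobotState n))).continuous).inter
  (isClosed_le continuous_const ((innerSL ℝ (gradient h x).snd).comp
    (WithLp.sndL 2 ℝ (RobotState n) (RobotState n))).continuous)

theorem convex_qpFeasible (h : JointState n → ℝ) (α : ℝ → ℝ) (x : JointState n) :
    Convex ℝ (qpFeasible h α x) :=
  (convex_halfSpace_ge ((innerₛₗ ℝ (gradient h x).fst).comp
    (WithLp.fstL 2 ℝ (RobotState n) (RobotState n)).toLinearMap).isLinear _).inter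
  (convex_halfSpace_ge ((innerₛₗ ℝ (gradient h x).snd).comp
    (WithLp.sndL 2 ℝ (RobotState n) (RobotState n)).toLinearMap).isLinear _)

theorem existsUnique_mem_safetyFilter {h : JointState n → ℝ} {α : ℝ → ℝ}
    (hα : IsExtendedClassK α) (u₀ : JointState n → JointState n) {x : JointState n}
    (hx : 0 ≤ h x) : ∃! u, u ∈ safetyFilter h α u₀ x := by
  have hα0 : 0 ≤ α (h x) := hα.map_zero ▸ hα.strictMono.monotone hx
  -- On the superlevel set `α (h x) ≥ 0`, so the zero input is feasible.
  refine existsUnique_norm_sub_sq_le ⟨0, ?_⟩ (isClosed_qpFeasible h α x) (convex_qpFeasible h α x)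
    (u₀ x)
  constructor <;> simp [hα0]

theorem forwardInvariant_safetyFilter {h : JointState n → ℝ} {α : ℝ → ℝ}
    (hd : Differentiable ℝ h) (hα : IsExtendedClassK α) (u₀ : JointState n → JointState n) :
    ForwardInvariant (integratorDrift n) (integratorInput n) (safetyFilter h α u₀)
      {x | 0 ≤ h x} :=
  forwardInvariant_superlevel hd hα fun x _ hu => qpFeasible_subset_admissibleInputs h α x hu.1

end TwoRobots

end PolygonCBF

theorem theorem3 {n ri rj : ℕ} (hn : 2 ≤ n)
    (Pi : PolygonFamily n ri) (Pj : PolygonFamily n rj)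
    (hPi : Pi.IsRegular) (hPj : Pj.IsRegular)
    (b : ℝ) (hb : Real.log ((ri : ℝ) + (rj : ℝ)) ≤ b) :
    -- if some configuration has positive clearance, every large enough `κ` is admissible
    ((∃ x : JointState n, 0 < hs Pi Pj x) →
      ∃ κ₀ : ℝ, 0 < κ₀ ∧ ∀ κ : ℝ, κ₀ ≤ κ → (hatSet Pi Pj b κ).Nonempty) ∧
    -- the conclusion holds for every `κ > 0` that is large enough for `Ŝ_a` to be nonempty
    ∀ κ : ℝ, 0 < κ → (hatSet Pi Pj b κ).Nonempty →
      (∀ x : JointState n, hHat Pi Pj b κ x = 0 → gradient (hHat Pi Pj b κ) x ≠ 0) →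
      ∃ D : Set (JointState n), IsOpen D ∧ hatSet Pi Pj b κ ⊆ D ∧
        IsCBF (integratorDrift n) (integratorInput n) (hatSet Pi Pj b κ) D (hHat Pi Pj b κ) ∧
        ∀ u₀ : JointState n → JointState n, LocallyLipschitz u₀ →
        ∀ α : ℝ → ℝ, IsExtendedClassK α →
          (∀ x ∈ hatSet Pi Pj b κ, ∃! u, u ∈ safetyFilter (hHat Pi Pj b κ) α u₀ x) ∧
          ForwardInvariant (integratorDrift n) (integratorInput n)
            (safetyFilter (hHat Pi Pj b κ) α u₀) (hatSet Pi Pj b κ) ∧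
          StaysIn (integratorDrift n) (integratorInput n)
            (safetyFilter (hHat Pi Pj b κ) α u₀) (hatSet Pi Pj b κ) (safeSet Pi Pj) := by
  refine ⟨fun ⟨x, hx⟩ => exists_forall_hatSet_nonempty hPi hPj b hx, fun κ hκ hne hreg => ?_⟩
  -- Makes the joint state space nontrivial, as the absence of isolated points requires.
  have : Nonempty (Fin n) := ⟨⟨0, by omega⟩⟩
  have hC := contDiff_hHat hPi hPj b κ
  have hcbf := isCBF_integrator hC hne hreg
  refine ⟨_, hcbf.isOpen, hcbf.subset, hcbf, fun u₀ _ α hα => ?_⟩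
  have hinv := forwardInvariant_safetyFilter (hC.differentiable one_ne_zero) hα u₀
  exact ⟨fun x hx => existsUnique_mem_safetyFilter hα u₀ hx, hinv,
    fun T x hsol hx0 t ht0 htT =>
      hatSet_subset_safeSet hPi hPj hκ hb (hinv T x hsol hx0 t ht0 htT)⟩
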